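/- For positive integers $s_1,\dots,s_d$ and signs $\varepsilon_1,\dots,\varepsilon_d\in\{1,-1\}$ with $(s_1,\varepsilon_1)\neq(1,1)$ let $$\zeta(s_1,\dots,s_d;\varepsilon_1,\dots,\varepsilon_d)=\sum_{n_1>\cdots>n_d\ge 1}\frac{\varepsilon_1^{n_1}\cdots\varepsilon_d^{n_d}}{n_1^{s_1}\cdots n_d^{s_d}},$$ and for positive integers $d\le n$ put $$\Xi(2n,d)=\sum_{\substack{s_1+\cdots+s_d=n\\ s_1,\dots,s_d>0}}\xi(2s_1,\dots,2s_d),\qquad \xi(2s_1,\dots,2s_d)=\zeta\big(2s_1,\dots,2s_d;(-1)^{s_1},\dots,(-1)^{s_d}\big).$$ Let $\zeta$ be the Riemann zeta function, so that $\zeta(0)=-\tfrac12$, and for $m\ge 2$ let $\zeta(\overline m)=\sum_{k\ge1}(-1)^k/k^m$. Put $\tilde\zeta_n(m)=\zeta(m)$ if $n$ is even and $\tilde\zeta_n(m)=\zeta(\overline m)$ if $n$ is odd. **Theorem.** The series defining $\zeta(\overline m)$ converges and $\zeta(\overline m)=(2^{1-m}-1)\zeta(m)$ for all integers $m\ge 2$.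 For all positive integers $d\le n$ the series defining the $\xi(2s_1,\dots,2s_d)$ above converge, and $$\begin{aligned}\Xi(2n,d)={}&\sum_{j=0}^{\lfloor\frac{d-1}{2}\rfloor}\frac{(-1)^{\lfloor j/2\rfloor}\,\pi^{2j}\,\tilde\zeta_n(2n-2j)}{2^{2d-j-2}\,(2j+1)!}\binom{2d-2j-1}{d}\\ &+\sum_{j=0}^{\lfloor\frac{d-2}{4}\rfloor}\Bigg(\sum_{\substack{r+s=n-2j\\ r,s\ge0}}\frac{(-1)^r(4^r-1)}{4^{n-2j}}\,\zeta(2r)\,\zeta(2s)\Bigg)\frac{(-1)^j\,\pi^{4j}}{2^{2d-2j-5}\,(4j+2)!}\binom{2d-4j-2}{d},\end{aligned}$$ where the second sum over $j$ is empty if $d=1$. In particular, $\Xi(2n,d)$ is a rational multiple of $\pi^{2n}$. -/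

import Mathlib

open Filter Topology

namespace AltEuler

/-- The truncated Euler sum: the finite sum of
`∏ i, ε i ^ (n i) / (n i) ^ (s i)` over all integers `N ≥ n_1 > n_2 > ⋯ > n_d ≥ 1`.
The signs `ε i` are units of `ℤ`, that is, `1` or `-1`. -/
noncomputable def truncEulerSum {d : ℕ} (s : Fin d → ℕ) (ε : Fin d → ℤˣ) (N : ℕ) : ℝ :=
  ∑ n ∈ (Fintype.piFinset fun _ : Fin d => Finset.Icc 1 N).filter
      (fun n => ∀ i j : Fin d, i < j → n j < n i),
    ∏ i, ((ε i : ℤ) : ℝ) ^ n i / (n i : ℝ) ^ s i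

/-- The series `ζ(s_1, …, s_d; ε_1, …, ε_d)`, summed as an iterated series
(the outermost summation variable is `n_1`), converges to `a`. -/
def HasEulerSum {d : ℕ} (s : Fin d → ℕ) (ε : Fin d → ℤˣ) (a : ℝ) : Prop :=
  Tendsto (truncEulerSum s ε) atTop (𝓝 a)

/-- The (alternating) Euler sum `ζ(s_1, …, s_d; ε_1, …, ε_d)`. -/
noncomputable def eulerSum {d : ℕ} (s : Fin d → ℕ) (ε : Fin d → ℤˣ) : ℝ :=
  limUnder atTop (truncEulerSum s ε)

/-- `ξ(2 s_1, …, 2 s_d) = ζ(2 s_1, …, 2 s_d; (-1)^{s_1}, …, (-1)^{s_d})`, as a function of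
`s_1, …, s_d`. -/
noncomputable def xi {d : ℕ} (s : Fin d → ℕ) : ℝ :=
  eulerSum (fun i => 2 * s i) (fun i => (-1) ^ s i)

/-- The compositions of `n` into `d` positive parts. -/
def comps (n d : ℕ) : Finset (Fin d → ℕ) :=
  (Finset.Nat.antidiagonalTuple d n).filter (fun s => ∀ i, 0 < s i)

/-- `Xi n d` is `Ξ(2n, d)`, the sum of `ξ(2 s_1, …, 2 s_d)` over all compositions
`s_1 + ⋯ + s_d = n` into positive parts. -/
noncomputable def Xi (n d : ℕ) : ℝ :=
  ∑ s ∈ comps n d, xi s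

/-- The alternating zeta value `ζ(m̄) = ∑_{k ≥ 1} (-1)^k / k^m`, the Euler sum of depth one
with sign `-1`. -/
noncomputable def zetaBar (m : ℕ) : ℝ :=
  eulerSum (fun _ : Fin 1 => m) (fun _ => -1)

/-- `ζ̃_n(m)`: it is `ζ(m)` if `n` is even and `ζ(m̄)` if `n` is odd. -/
noncomputable def zetaTilde (n m : ℕ) : ℂ :=
  if Even n then riemannZeta (m : ℂ) else (zetaBar m : ℂ)

/-- The convolution `∑_{r + s = m, r, s ≥ 0} ((-1)^r (4^r - 1) / 4^m) ζ(2r) ζ(2s)`,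
where `ζ(0) = -1/2`. -/
noncomputable def zetaConv (m : ℕ) : ℂ :=
  ∑ p ∈ Finset.HasAntidiagonal.antidiagonal m,
    (-1 : ℂ) ^ p.1 * ((4 : ℂ) ^ p.1 - 1) / (4 : ℂ) ^ m *
      riemannZeta (2 * (p.1 : ℂ)) * riemannZeta (2 * (p.2 : ℂ))

end AltEuler

/-!
The sum of `ξ(2 s₁, …, 2 s_d)` over all compositions is the coefficient of `X ^ n` in the `d`-th
elementary symmetric function of the series `a_k X / (1 - a_k X)`, `a_k = (-1) ^ k / k ^ 2`.
Multiplying this symmetric function by `P = ∏ (1 - a_k X)` gives `(-1) ^ d X ^ d / d! · P^{(d)}`,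
an elementary identity which holds for finite products (`esymm_geomTail_mul_prod`) and passes to the
limit coefficientwise (`XiSeries_mul_prodSeries`). Thus the generating function of `Ξ(2n, d)` for
fixed `d` is `(-1) ^ d X ^ d / d! · P^{(d)} / P`.

The limit is `P = sin u cosh u / u` with `u ^ 2 = π ^ 2 X / 4`. This is derived without complex
analysis: for `d = 1` the identity above is Newton's identity `X P' = -P ∑ p_s X ^ s`, so that
the coefficients of `P` are determined by the power sums `p_s = ∑ a_k ^ s`, which are explicit
multiples of values of `ζ` at even integers, and the logarithmic derivative of `sin u cosh u / u`
(for `θ = X d/dX`) is `(u cot u - 1 + u tanh u) / 2`, whose coefficients are given by the same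
zeta values. In terms of Bernoulli numbers the expansion of `cot` amounts to the vanishing of the
odd Bernoulli polynomials at `1 / 2` (`sinSeries_mul_cotSeries`), and that of `tanh` follows from
`tanh u = 2 coth (2 u) - coth u` (`coshSeries_mul_tanhSeries`).

For the higher derivatives, `sin u cosh u` is the mean of `sin ((1 + i) u)` and `sin ((1 - i) u)`.
The series `U = sin (a u) / u`, `V = cos (a u)` satisfy a linear system of first order with respect
to `θ`, and induction on `d` gives `X ^ d / d! · U^{(d)} = p U + q V` with explicit
polynomials `p`, `q` of degree less than `d` (`thetaChoose_eq_of_system`). Since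
`sin ((1 ± i) u) = sin u cosh u ± i cos u sinh u` and
`cos ((1 ± i) u) = cos u cosh u ∓ i sin u sinh u`, division by `sin u cosh u` leaves a polynomial
of degree less than `d`, a polynomial multiple of `cot u tanh u`, which produces the second sum of
the formula, and polynomial multiples of `cot u` and `tanh u`, which combine to the first one
(`two_smul_thetaChoose_sinCoshSeries`, `Xi_eq`).
-/

namespace AltEuler

open PowerSeries Finset

/-! ### The Euler operator and a linear system of power series -/

section Formal

variable {K : Type*} [Field K]

/-- The Euler operator `X · d/dX` on formal power series. -/
noncomputable def theta : Derivation K K⟦X⟧ K⟦X⟧ := (X : K⟦X⟧) • PowerSeries.derivative K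

lemma coeff_theta (A : K⟦X⟧) (k : ℕ) : coeff k (theta A) = k * coeff k A := by
  cases k with
  | zero => simp [theta]
  | succ k => simp [theta, coeff_succ_X_mul, coeff_derivative, mul_comm]

/-- The operator `X ^ d / d! · (d/dX) ^ d` on formal power series, which multiplies the
coefficient of `X ^ k` by `k.choose d`. -/
noncomputable def thetaChoose (d : ℕ) (A : K⟦X⟧) : K⟦X⟧ := mk fun k => (k.choose d : K) * coeff k A

@[simp]
lemma coeff_thetaChoose (d k : ℕ) (A : K⟦X⟧) :
    coeff k (thetaChoose d A) = (k.choose d : K) * coeff k A := by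
  simp [thetaChoose]

lemma thetaChoose_zero (A : K⟦X⟧) : thetaChoose 0 A = A := by
  ext k; simp

lemma thetaChoose_one (A : K⟦X⟧) : thetaChoose 1 A = theta A := by
  ext k; simp [coeff_theta]

lemma thetaChoose_add (d : ℕ) (A B : K⟦X⟧) :
    thetaChoose d (A + B) = thetaChoose d A + thetaChoose d B := by
  ext k; simp [mul_add]

lemma thetaChoose_rescale (d : ℕ) (c : K) (A : K⟦X⟧) :
    thetaChoose d (rescale c A) = rescale c (thetaChoose d A) := by
  ext k; simp [coeff_rescale]; ring

lemma thetaChoose_map {L : Type*} [Field L] (f : K →+* L) (d : ℕ) (A : K⟦X⟧) :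
    map f (thetaChoose d A) = thetaChoose d (map f A) := by
  ext k; simp

lemma theta_rescale (c : K) (A : K⟦X⟧) : theta (rescale c A) = rescale c (theta A) := by
  simp only [← thetaChoose_one, thetaChoose_rescale]

lemma rescale_C (c a : K) : rescale c (C a) = C a := by
  ext k
  rcases eq_or_ne k 0 with rfl | hk
  · simp only [coeff_rescale]; simp
  · simp [coeff_rescale, coeff_C, hk]

lemma constantCoeff_rescale (c : K) (A : K⟦X⟧) :
    constantCoeff (rescale c A) = constantCoeff A := by
  rw [← coeff_zero_eq_constantCoeff_apply, coeff_rescale]; simp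

lemma choose_succ_mul_cast (k d : ℕ) :
    ((d : K) + 1) * (k.choose (d + 1) : K) = ((k : K) - d) * (k.choose d : K) := by
  rcases le_or_gt d k with h | h
  · have := Nat.choose_succ_right_eq k d
    have h2 : ((k.choose (d + 1) * (d + 1) : ℕ) : K) = ((k.choose d * (k - d) : ℕ) : K) := by
      rw [this]
    push_cast [Nat.cast_sub h] at h2
    linear_combination h2
  · simp [Nat.choose_eq_zero_of_lt h, Nat.choose_eq_zero_of_lt (Nat.lt_succ_of_lt h)]

lemma succ_smul_thetaChoose_succ (d : ℕ) (A : K⟦X⟧) :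
    ((d : K) + 1) • thetaChoose (d + 1) A =
      theta (thetaChoose d A) - (d : K) • thetaChoose d A := by
  ext k
  simp only [map_smul, map_sub, coeff_thetaChoose, coeff_theta, smul_eq_mul]
  linear_combination coeff k A * choose_succ_mul_cast (K := K) k d

/-- The Leibniz rule for multiplication by a linear polynomial. -/
lemma thetaChoose_succ_mul_linear (d : ℕ) (a : K) (A : K⟦X⟧) :
    thetaChoose (d + 1) (A * (1 - C a * X)) =
      thetaChoose (d + 1) A * (1 - C a * X) - C a * X * thetaChoose d A := by
  have e (B : K⟦X⟧) : B * (1 - C a * X) = B - C a * (X * B) := by ring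
  rw [e, e, mul_assoc]
  ext k
  cases k with
  | zero => simp only [coeff_thetaChoose, map_sub]; simp
  | succ k => simp [coeff_succ_X_mul, Nat.choose_succ_succ]; ring

/-- The coefficient of `U` in the expansion of `thetaChoose d U` for a solution `(U, V)` of the
system `2 θ U = a V - U`, `2 θ V = - a X U`; see `thetaChoose_eq_of_system`. -/
noncomputable def systemCoeffFst (a : K) (d : ℕ) : K⟦X⟧ :=
  mk fun m => (-1) ^ d * (-4) ^ m * a ^ (2 * m) * ((2 * d - 2 * m).choose d : K) /
    ((2 * m).factorial * 4 ^ d)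

/-- The coefficient of `V` in the expansion of `thetaChoose d U` for a solution `(U, V)` of the
system `2 θ U = a V - U`, `2 θ V = - a X U`; see `thetaChoose_eq_of_system`. -/
noncomputable def systemCoeffSnd (a : K) (d : ℕ) : K⟦X⟧ :=
  mk fun j => -(-1) ^ d * 2 * (-4) ^ j * a ^ (2 * j + 1) * ((2 * d - 2 * j - 1).choose d : K) /
    ((2 * j + 1).factorial * 4 ^ d)

variable [CharZero K]

lemma systemCoeffSnd_succ (a : K) {d : ℕ} (hd : 1 ≤ d) :
    (2 * ((d : K) + 1)) • systemCoeffSnd a (d + 1) =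
      (2 : K) • theta (systemCoeffSnd a d) - (2 * d : K) • systemCoeffSnd a d
        + a • systemCoeffFst a d := by
  ext j
  simp only [map_smul, map_sub, map_add, coeff_theta, smul_eq_mul, systemCoeffFst, systemCoeffSnd,
    coeff_mk]
  have hf : ((2 * j + 1).factorial : K) = (2 * j + 1) * ((2 * j).factorial : K) := by
    rw [Nat.factorial_succ]; push_cast; ring
  have h0 : ((2 * j).factorial : K) ≠ 0 := by exact_mod_cast Nat.factorial_ne_zero _
  have h1 : (2 * j + 1 : K) ≠ 0 := by exact_mod_cast Nat.succ_ne_zero (2 * j)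
  have key : ((d : K) + 1) * ((2 * (d + 1) - 2 * j - 1).choose (d + 1) : K) =
      4 * (d - j) * ((2 * d - 2 * j - 1).choose d : K)
        + (2 * j + 1) * ((2 * d - 2 * j).choose d : K) := by
    rcases lt_trichotomy j d with h | h | h
    · obtain ⟨e, rfl⟩ := Nat.exists_eq_add_of_lt h
      have e1 : 2 * (j + e + 1 + 1) - 2 * j - 1 = 2 * e + 2 + 1 := by omega
      have e2 : 2 * (j + e + 1) - 2 * j - 1 = 2 * e + 1 := by omega
      have e3 : 2 * (j + e + 1) - 2 * j = 2 * e + 1 + 1 := by omega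
      rw [e1, e2, e3]
      have a1 := congrArg (Nat.cast (R := K)) (Nat.add_one_mul_choose_eq (2 * e + 2) (j + e + 1))
      have a2 := congrArg (Nat.cast (R := K)) (Nat.choose_mul_succ_eq (2 * e + 1) (j + e + 1))
      rcases le_or_gt (j + e + 1) (2 * e + 1 + 1) with h' | h'
      · rw [Nat.cast_mul, Nat.cast_mul, Nat.cast_sub h'] at a2
        push_cast at a1 a2 ⊢
        linear_combination -a1 - 2 * a2
      · rw [Nat.choose_eq_zero_of_lt (show 2 * e + 2 + 1 < j + e + 1 + 1 by omega),
          Nat.choose_eq_zero_of_lt h', Nat.choose_eq_zero_of_lt (by omega)]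
        simp
    · subst h
      have e1 : 2 * (j + 1) - 2 * j - 1 = 1 := by omega
      have e2 : 2 * j - 2 * j - 1 = 0 := by omega
      rw [e1, e2, Nat.sub_self, Nat.choose_eq_zero_of_lt (show 1 < j + 1 by omega),
        Nat.choose_eq_zero_of_lt (show 0 < j by omega)]
      simp
    · have e1 : 2 * (d + 1) - 2 * j - 1 = 0 := by omega
      have e2 : 2 * d - 2 * j - 1 = 0 := by omega
      have e3 : 2 * d - 2 * j = 0 := by omega
      rw [e1, e2, e3, Nat.choose_eq_zero_of_lt (show 0 < d + 1 by omega),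
        Nat.choose_eq_zero_of_lt (show 0 < d by omega)]
      simp
  rw [hf]
  field_simp
  rw [pow_succ (-1 : K), pow_succ (4 : K)]
  linear_combination 4 * a * a ^ (2 * j) * (-1) ^ d * 4 ^ d * key

lemma systemCoeffFst_succ (a : K) {d : ℕ} (hd : 1 ≤ d) :
    (2 * ((d : K) + 1)) • systemCoeffFst a (d + 1) =
      (2 : K) • theta (systemCoeffFst a d) - (2 * d + 1 : K) • systemCoeffFst a d
        - a • (X * systemCoeffSnd a d) := by
  ext m
  cases m with
  | zero =>
    simp only [map_smul, map_sub, coeff_theta, smul_eq_mul, systemCoeffFst, coeff_mk,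
      coeff_zero_X_mul]
    have key : ((d : K) + 1) * ((2 * (d + 1) - 2 * 0).choose (d + 1) : K) =
        (4 * d + 2) * ((2 * d - 2 * 0).choose d : K) := by
      have a1 := congrArg (Nat.cast (R := K)) (Nat.add_one_mul_choose_eq (2 * d + 1) d)
      have a2 := congrArg (Nat.cast (R := K)) (Nat.choose_mul_succ_eq (2 * d) d)
      rw [Nat.cast_mul, Nat.cast_mul, Nat.cast_sub (by omega)] at a2
      have e1 : 2 * (d + 1) - 2 * 0 = 2 * d + 1 + 1 := by omega
      rw [e1]
      push_cast at a1 a2 ⊢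
      linear_combination -a1 - 2 * a2
    field_simp
    rw [pow_succ (-1 : K), pow_succ (4 : K)]
    push_cast
    linear_combination -2 * (-1) ^ d * 4 ^ d * key
  | succ m =>
    simp only [map_smul, map_sub, coeff_theta, smul_eq_mul, systemCoeffFst, systemCoeffSnd,
      coeff_mk, coeff_succ_X_mul]
    have hf : ((2 * (m + 1)).factorial : K) = (2 * m + 2) * ((2 * m + 1).factorial : K) := by
      rw [show 2 * (m + 1) = 2 * m + 1 + 1 by ring, Nat.factorial_succ]; push_cast; ring
    have h0 : ((2 * m + 1).factorial : K) ≠ 0 := by exact_mod_cast Nat.factorial_ne_zero _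
    have h1 : (m + 1 : K) ≠ 0 := by exact_mod_cast Nat.succ_ne_zero m
    have h2 : (2 * m + 2 : K) = 2 * (m + 1) := by ring
    have key : ((d : K) + 1) * ((2 * (d + 1) - 2 * (m + 1)).choose (d + 1) : K) =
        (4 * (d - m - 1) + 2) * ((2 * d - 2 * (m + 1)).choose d : K)
          + (2 * m + 2) * ((2 * d - 2 * m - 1).choose d : K) := by
      rcases lt_or_ge m d with h | h
      · obtain ⟨e, rfl⟩ := Nat.exists_eq_add_of_lt h
        have e1 : 2 * (m + e + 1 + 1) - 2 * (m + 1) = 2 * e + 1 + 1 := by omega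
        have e2 : 2 * (m + e + 1) - 2 * (m + 1) = 2 * e := by omega
        have e3 : 2 * (m + e + 1) - 2 * m - 1 = 2 * e + 1 := by omega
        rw [e1, e2, e3]
        have a1 := congrArg (Nat.cast (R := K)) (Nat.add_one_mul_choose_eq (2 * e + 1) (m + e + 1))
        have a2 := congrArg (Nat.cast (R := K)) (Nat.choose_mul_succ_eq (2 * e) (m + e + 1))
        rcases le_or_gt (m + e + 1) (2 * e + 1) with h' | h'
        · rw [Nat.cast_mul, Nat.cast_mul, Nat.cast_sub h'] at a2
          push_cast at a1 a2 ⊢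
          linear_combination -a1 - 2 * a2
        · rw [Nat.choose_eq_zero_of_lt (show 2 * e + 1 + 1 < m + e + 1 + 1 by omega),
            Nat.choose_eq_zero_of_lt h', Nat.choose_eq_zero_of_lt (by omega)]
          simp
      · have e1 : 2 * (d + 1) - 2 * (m + 1) = 0 := by omega
        have e2 : 2 * d - 2 * (m + 1) = 0 := by omega
        have e3 : 2 * d - 2 * m - 1 = 0 := by omega
        rw [e1, e2, e3, Nat.choose_eq_zero_of_lt (show 0 < d + 1 by omega),
          Nat.choose_eq_zero_of_lt (show 0 < d by omega)]
        simp
    rw [hf, h2]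
    field_simp
    rw [pow_succ (-1 : K), pow_succ (4 : K), pow_succ (-4 : K)]
    push_cast
    linear_combination 8 * a ^ (2 * (m + 1)) * (-4) ^ m * (-1) ^ d * 4 ^ d * key

/-- If `2 θ U = a V - U` and `2 θ V = - a X U`, then `X ^ d / d! · (d/dX) ^ d U` is an explicit
combination of `U` and `V` with polynomial coefficients. -/
theorem thetaChoose_eq_of_system {a : K} {U V : K⟦X⟧} (hU : (2 : K) • theta U = a • V - U)
    (hV : (2 : K) • theta V = -(a • (X * U))) {d : ℕ} (hd : 1 ≤ d) :
    thetaChoose d U = systemCoeffFst a d * U + systemCoeffSnd a d * V := by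
  have h20 : (C (2 : K)) ≠ 0 := by simp
  simp only [smul_eq_C_mul] at hU hV
  induction d, hd using Nat.le_induction with
  | base =>
    have h1 : systemCoeffFst a 1 = C (-1 / 2) := by
      ext m
      rcases m with _ | m
      · simp [systemCoeffFst]; norm_num
      · simp [systemCoeffFst, show 2 - 2 * (m + 1) = 0 by omega]
    have h2 : systemCoeffSnd a 1 = C (a / 2) := by
      ext m
      rcases m with _ | m
      · simp [systemCoeffSnd]; ring
      · simp [systemCoeffSnd]
    rw [h1, h2, thetaChoose_one]
    refine mul_left_cancel₀ h20 ?_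
    have e1 : C (2 : K) * C (-1 / 2) = -1 := by rw [← map_mul]; norm_num
    have e2 : C (2 : K) * C (a / 2) = C a := by rw [← map_mul]; congr 1; field_simp
    linear_combination hU - U * e1 - V * e2
  | succ d hd ih =>
    have h3 : C (2 * ((d : K) + 1)) ≠ 0 := by
      rw [Ne, map_eq_zero_iff _ C_injective]
      exact mul_ne_zero two_ne_zero (Nat.cast_add_one_ne_zero d)
    refine mul_left_cancel₀ h3 ?_
    have s0 := succ_smul_thetaChoose_succ d U
    have s1 := systemCoeffFst_succ a hd
    have s2 := systemCoeffSnd_succ a hd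
    rw [ih, map_add, Derivation.leibniz, Derivation.leibniz] at s0
    simp only [smul_eq_C_mul, smul_eq_mul] at s0 s1 s2
    simp only [map_mul, map_add, map_one] at s0 s1 s2 ⊢
    linear_combination C (2 : K) * s0 - U * s1 - V * s2 + systemCoeffFst a d * hU
      + systemCoeffSnd a d * hV

/-- A solution of `2 θ U = V - U`, `2 θ V = b X U` is determined by the constant term of `V`; as
the system is linear, it suffices to treat the value zero. -/
lemma eq_zero_of_system {b : K} {U V : K⟦X⟧} (hU : (2 : K) • theta U = V - U)
    (hV : (2 : K) • theta V = b • (X * U)) (h0 : coeff 0 V = 0) : U = 0 ∧ V = 0 := by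
  have hu (k : ℕ) (h : coeff k V = 0) : coeff k U = 0 := by
    have := congrArg (coeff k) hU
    simp only [map_smul, map_sub, coeff_theta, smul_eq_mul, h] at this
    have h1 : (2 * k + 1 : K) ≠ 0 := by exact_mod_cast Nat.succ_ne_zero (2 * k)
    refine (mul_eq_zero.mp (?_ : (2 * k + 1 : K) * coeff k U = 0)).resolve_left h1
    linear_combination this
  have hv (k : ℕ) : coeff k V = 0 := by
    induction k with
    | zero => exact h0
    | succ k ih =>
      have := congrArg (coeff (k + 1)) hV
      simp only [map_smul, coeff_theta, smul_eq_mul, coeff_succ_X_mul, hu k ih] at this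
      have h1 : (k + 1 : K) ≠ 0 := by exact_mod_cast Nat.succ_ne_zero k
      simpa [h1] using this
  exact ⟨by ext k; simpa using hu k (hv k), by ext k; simpa using hv k⟩

end Formal

/-! ### Trigonometric and hyperbolic power series -/

section Trigonometric

variable (K : Type*) [Field K]

/-- The power series `sin u / u` in the variable `X = u ^ 2`. -/
noncomputable def sinSeries : K⟦X⟧ := mk fun k => (-1) ^ k / ((2 * k + 1).factorial : K)

/-- The power series `cos u` in the variable `X = u ^ 2`. -/
noncomputable def cosSeries : K⟦X⟧ := mk fun k => (-1) ^ k / ((2 * k).factorial : K)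

/-- The power series `sinh u / u` in the variable `X = u ^ 2`. -/
noncomputable def sinhSeries : K⟦X⟧ := rescale (-1) (sinSeries K)

/-- The power series `cosh u` in the variable `X = u ^ 2`. -/
noncomputable def coshSeries : K⟦X⟧ := rescale (-1) (cosSeries K)

/-- The power series `u cot u` in the variable `X = u ^ 2`. -/
noncomputable def cotSeries [CharZero K] : K⟦X⟧ :=
  mk fun k => (-4) ^ k * ((bernoulli (2 * k) : ℚ) : K) / ((2 * k).factorial : K)

/-- The power series `u tanh u` in the variable `X = u ^ 2`, in the form
`2 u coth (2 u) - u coth u`. -/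
noncomputable def tanhSeries [CharZero K] : K⟦X⟧ :=
  rescale 4 (rescale (-1) (cotSeries K)) - rescale (-1) (cotSeries K)

variable [CharZero K]

lemma two_smul_theta_sinSeries : (2 : K) • theta (sinSeries K) = cosSeries K - sinSeries K := by
  ext k
  simp only [map_smul, map_sub, coeff_theta, sinSeries, cosSeries, coeff_mk, smul_eq_mul]
  have hf : ((2 * k + 1).factorial : K) = (2 * k + 1) * ((2 * k).factorial : K) := by
    rw [Nat.factorial_succ]; push_cast; ring
  have h0 : ((2 * k).factorial : K) ≠ 0 := by exact_mod_cast Nat.factorial_ne_zero _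
  have h1 : (2 * k + 1 : K) ≠ 0 := by exact_mod_cast Nat.succ_ne_zero (2 * k)
  rw [hf]
  field_simp
  ring

lemma two_smul_theta_cosSeries : (2 : K) • theta (cosSeries K) = -(X * sinSeries K) := by
  ext k
  rcases k with _ | k
  · simp [coeff_theta]
  simp only [map_smul, map_neg, coeff_theta, sinSeries, cosSeries, coeff_mk, smul_eq_mul,
    coeff_succ_X_mul]
  have hf : ((2 * (k + 1)).factorial : K) = 2 * (k + 1) * ((2 * k + 1).factorial : K) := by
    rw [show 2 * (k + 1) = 2 * k + 1 + 1 by ring, Nat.factorial_succ]; push_cast; ring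
  have h0 : ((2 * k + 1).factorial : K) ≠ 0 := by exact_mod_cast Nat.factorial_ne_zero _
  have h1 : (k + 1 : K) ≠ 0 := by exact_mod_cast Nat.succ_ne_zero k
  rw [hf]
  field_simp
  push_cast
  ring

lemma two_smul_theta_sinhSeries :
    (2 : K) • theta (sinhSeries K) = coshSeries K - sinhSeries K := by
  have := congrArg (rescale (-1 : K)) (two_smul_theta_sinSeries K)
  rw [smul_eq_C_mul] at this ⊢
  simpa [sinhSeries, coshSeries, theta_rescale, rescale_C] using this

lemma two_smul_theta_coshSeries : (2 : K) • theta (coshSeries K) = X * sinhSeries K := by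
  have := congrArg (rescale (-1 : K)) (two_smul_theta_cosSeries K)
  rw [smul_eq_C_mul] at this ⊢
  simpa [sinhSeries, coshSeries, theta_rescale, rescale_X, rescale_C] using this

lemma coeff_zero_sinSeries : coeff 0 (sinSeries K) = 1 := by simp [sinSeries]

lemma coeff_zero_coshSeries : coeff 0 (coshSeries K) = 1 := by simp [coshSeries, cosSeries]

lemma sinhSeries_ne_zero : sinhSeries K ≠ 0 := fun h => by
  have := congrArg (coeff 0) h; simp [sinhSeries, sinSeries] at this

/-- The double angle formulas for `sinh` and `cosh`. -/
lemma rescale_four_sinhSeries_and_coshSeries :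
    rescale 4 (sinhSeries K) = sinhSeries K * coshSeries K ∧
      rescale 4 (coshSeries K) = coshSeries K ^ 2 + X * sinhSeries K ^ 2 := by
  have hs := two_smul_theta_sinhSeries K
  have hc := two_smul_theta_coshSeries K
  have hs4 := congrArg (rescale (4 : K)) hs
  have hc4 := congrArg (rescale (4 : K)) hc
  have hX : theta (X : K⟦X⟧) = X := by simp [theta]
  rw [smul_eq_C_mul] at hs hc hs4 hc4
  simp only [map_mul, map_sub, rescale_C, ← theta_rescale, rescale_X] at hs4 hc4
  have h := eq_zero_of_system (b := (4 : K))
    (U := rescale 4 (sinhSeries K) - sinhSeries K * coshSeries K)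
    (V := rescale 4 (coshSeries K) - (coshSeries K ^ 2 + X * sinhSeries K ^ 2)) ?_ ?_ ?_
  · exact ⟨sub_eq_zero.mp h.1, sub_eq_zero.mp h.2⟩
  · rw [smul_eq_C_mul, map_sub, Derivation.leibniz]
    simp only [smul_eq_mul]
    linear_combination hs4 - sinhSeries K * hc - coshSeries K * hs
  · rw [smul_eq_C_mul, smul_eq_C_mul, map_sub, map_add, Derivation.leibniz, Derivation.leibniz_pow,
      Derivation.leibniz_pow, hX]
    simp only [smul_eq_mul, nsmul_eq_mul]
    have e2 : (C (2 : K)) = 2 := map_ofNat C 2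
    have e4 : (C (4 : K)) = 4 := map_ofNat C 4
    rw [e2] at hs hc hs4 hc4
    rw [e4] at hc4
    rw [e2, e4]
    push_cast
    linear_combination hc4 - 2 * coshSeries K * hc - 2 * X * sinhSeries K * hs
  · simp [coshSeries, cosSeries, constantCoeff_rescale]

lemma sum_four_pow_mul_bernoulli (k : ℕ) :
    ∑ s ∈ range (k + 1), (4 : ℚ) ^ s * bernoulli (2 * s) * (2 * k + 1).choose (2 * s) =
      2 * k + 1 := by
  have hsplit (f : ℕ → ℚ) (m : ℕ) :
      ∑ i ∈ range (2 * m), f i = ∑ s ∈ range m, f (2 * s) + ∑ s ∈ range m, f (2 * s + 1) := by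
    induction m with
    | zero => simp
    | succ m ih =>
      rw [show 2 * (m + 1) = 2 * m + 1 + 1 by ring, sum_range_succ, sum_range_succ, ih,
        sum_range_succ, sum_range_succ]
      ring
  have h : (Polynomial.bernoulli (2 * k + 1)).eval (1 / 2) = 0 := by
    have := Polynomial.bernoulli_eval_one_sub (2 * k + 1) (1 / 2)
    rw [pow_succ, pow_mul] at this
    norm_num at this
    norm_num
    linarith
  simp only [Polynomial.bernoulli, Polynomial.eval_finsetSum, Polynomial.eval_monomial] at h
  rw [show 2 * k + 1 + 1 = 2 * (k + 1) by ring, hsplit] at h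
  -- among the odd indices only the Bernoulli number of index one contributes
  have hodd : ∑ s ∈ range (k + 1), bernoulli (2 * s + 1) * ((2 * k + 1).choose (2 * s + 1) : ℚ) *
      (1 / 2) ^ (2 * k + 1 - (2 * s + 1)) = -(1 / 2) * (2 * k + 1) * (1 / 2) ^ (2 * k) := by
    rw [sum_eq_single 0]
    · simp; ring
    · intro s _ hs
      rw [bernoulli_eq_zero_of_odd (odd_two_mul_add_one s) (by omega)]
      simp
    · simp
  rw [hodd] at h
  have heven : ∑ s ∈ range (k + 1), bernoulli (2 * s) * ((2 * k + 1).choose (2 * s) : ℚ) *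
      (1 / 2) ^ (2 * k + 1 - 2 * s) = (1 / 2) ^ (2 * k + 1) *
        ∑ s ∈ range (k + 1), (4 : ℚ) ^ s * bernoulli (2 * s) * (2 * k + 1).choose (2 * s) := by
    rw [mul_sum]
    refine sum_congr rfl fun s hs => ?_
    have hs' : 2 * s ≤ 2 * k + 1 := by have := mem_range.mp hs; omega
    obtain ⟨t, ht⟩ := Nat.exists_eq_add_of_le hs'
    rw [ht, Nat.add_sub_cancel_left, pow_add, pow_mul, show (1 / 2 : ℚ) ^ 2 = 1 / 4 by norm_num]
    have : (1 / 4 : ℚ) ^ s * 4 ^ s = 1 := by rw [← mul_pow]; norm_num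
    linear_combination -(bernoulli (2 * s) * ((2 * s + t).choose (2 * s) : ℚ) * (1 / 2) ^ t) * this
  rw [heven, pow_succ] at h
  have h2 : (1 / 2 : ℚ) ^ (2 * k) ≠ 0 := by positivity
  refine mul_left_cancel₀ h2 ?_
  linear_combination 2 * h

lemma sinSeries_mul_cotSeries : sinSeries K * cotSeries K = cosSeries K := by
  ext k
  rw [mul_comm, coeff_mul, Nat.sum_antidiagonal_eq_sum_range_succ_mk]
  simp only [sinSeries, cosSeries, cotSeries, coeff_mk]
  have hk := congrArg (Rat.cast (K := K)) (sum_four_pow_mul_bernoulli k)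
  push_cast at hk
  have hf : ((2 * k + 1).factorial : K) = (2 * k + 1) * ((2 * k).factorial : K) := by
    rw [Nat.factorial_succ]; push_cast; ring
  have h0 : ((2 * k).factorial : K) ≠ 0 := by exact_mod_cast Nat.factorial_ne_zero _
  have h1 : (2 * k + 1 : K) ≠ 0 := by exact_mod_cast Nat.succ_ne_zero (2 * k)
  have h2 : ((-1) ^ k / ((2 * k).factorial : K)) =
      (-1) ^ k / ((2 * k + 1).factorial : K) * (2 * k + 1) := by
    rw [hf]; field_simp
  rw [h2, ← hk, mul_sum]
  refine sum_congr rfl fun s hs => ?_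
  have hs' : s ≤ k := by have := mem_range.mp hs; omega
  obtain ⟨t, rfl⟩ := Nat.exists_eq_add_of_le hs'
  rw [Nat.cast_choose K (show 2 * s ≤ 2 * (s + t) + 1 by omega),
    show 2 * (s + t) + 1 - 2 * s = 2 * t + 1 by omega, Nat.add_sub_cancel_left]
  have a0 : ((2 * s).factorial : K) ≠ 0 := by exact_mod_cast Nat.factorial_ne_zero _
  have a1 : ((2 * t + 1).factorial : K) ≠ 0 := by exact_mod_cast Nat.factorial_ne_zero _
  have a2 : ((2 * (s + t) + 1).factorial : K) ≠ 0 := by exact_mod_cast Nat.factorial_ne_zero _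
  have e1 : (-4 : K) ^ s = (-1) ^ s * 4 ^ s := by rw [← mul_pow]; norm_num
  field_simp
  rw [e1, pow_add]
  ring

lemma coshSeries_mul_tanhSeries : coshSeries K * tanhSeries K = X * sinhSeries K := by
  obtain ⟨h1, h2⟩ := rescale_four_sinhSeries_and_coshSeries K
  have h3 : sinhSeries K * rescale (-1) (cotSeries K) = coshSeries K := by
    rw [sinhSeries, coshSeries, ← map_mul, sinSeries_mul_cotSeries]
  have h4 : rescale 4 (sinhSeries K) * rescale 4 (rescale (-1) (cotSeries K)) =
      rescale 4 (coshSeries K) := by rw [← map_mul, h3]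
  rw [h1, h2] at h4
  refine mul_left_cancel₀ (sinhSeries_ne_zero K) ?_
  rw [tanhSeries]
  linear_combination h4 - coshSeries K * h3

/-- The power series `tanh u / u` in the variable `X = u ^ 2`. -/
noncomputable def tanhQuotSeries : K⟦X⟧ := mk fun k => coeff (k + 1) (tanhSeries K)

lemma X_mul_tanhQuotSeries : X * tanhQuotSeries K = tanhSeries K := by
  ext k
  rcases k with _ | k
  · simp [tanhSeries, constantCoeff_rescale]
  · simp [coeff_succ_X_mul, tanhQuotSeries]

lemma coshSeries_mul_tanhQuotSeries : coshSeries K * tanhQuotSeries K = sinhSeries K := by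
  refine mul_left_cancel₀ (X_ne_zero (R := K)) ?_
  rw [← coshSeries_mul_tanhSeries, ← X_mul_tanhQuotSeries]
  ring

/-- The power series `sin u cosh u / u` in the variable `X = u ^ 2`. -/
noncomputable def sinCoshSeries : K⟦X⟧ := sinSeries K * coshSeries K

lemma coeff_zero_sinCoshSeries : coeff 0 (sinCoshSeries K) = 1 := by
  have h1 := coeff_zero_sinSeries K
  have h2 := coeff_zero_coshSeries K
  simp only [coeff_zero_eq_constantCoeff] at h1 h2
  simp [sinCoshSeries, h1, h2]

/-- The logarithmic derivative of `sin u cosh u / u`. -/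
lemma two_smul_theta_sinCoshSeries : (2 : K) • theta (sinCoshSeries K) =
    sinCoshSeries K * (cotSeries K - 1 + tanhSeries K) := by
  have h1 := two_smul_theta_sinSeries K
  have h2 := two_smul_theta_coshSeries K
  have h3 := sinSeries_mul_cotSeries K
  have h4 := coshSeries_mul_tanhSeries K
  rw [smul_eq_C_mul] at h1 h2 ⊢
  rw [sinCoshSeries, Derivation.leibniz]
  simp only [smul_eq_mul]
  linear_combination coshSeries K * h1 + sinSeries K * h2 - coshSeries K * h3 - sinSeries K * h4

variable {K}

/-- For `i ^ 2 = -1` the series `sin u cosh u + i cos u sinh u = sin ((1 + i) u)`, divided by `u`,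
and `cos u cosh u - i sin u sinh u = cos ((1 + i) u)` satisfy the system of
`thetaChoose_eq_of_system` with `a = 1 + i`. Both are written as multiples of
`sin u cosh u / u`. -/
lemma thetaChoose_sinCoshSeries_mul {i : K} (hi : i ^ 2 = -1) {d : ℕ} (hd : 1 ≤ d) :
    thetaChoose d (sinCoshSeries K * (1 + C i * (cotSeries K * tanhQuotSeries K))) =
      sinCoshSeries K * (systemCoeffFst (1 + i) d * (1 + C i * (cotSeries K * tanhQuotSeries K))
        + systemCoeffSnd (1 + i) d * (cotSeries K - C i * tanhSeries K)) := by
  have h1 := two_smul_theta_sinSeries K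
  have h2 := two_smul_theta_coshSeries K
  have h1' := two_smul_theta_cosSeries K
  have h2' := two_smul_theta_sinhSeries K
  have h3 := sinSeries_mul_cotSeries K
  have h4 := coshSeries_mul_tanhSeries K
  have h5 := coshSeries_mul_tanhQuotSeries K
  have hC : C i ^ 2 = (-1 : K⟦X⟧) := by rw [← map_pow, hi]; simp
  have hX : theta (X : K⟦X⟧) = X := by simp [theta]
  have hCi : theta (C i) = 0 := by simp [theta]
  have e1 : sinCoshSeries K * (1 + C i * (cotSeries K * tanhQuotSeries K)) =
      sinSeries K * coshSeries K + C i * (cosSeries K * sinhSeries K) := by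
    rw [← h3, ← h5, sinCoshSeries]; ring
  have e2 : sinCoshSeries K * (cotSeries K - C i * tanhSeries K) =
      cosSeries K * coshSeries K - C i * (X * (sinSeries K * sinhSeries K)) := by
    rw [← h3, sinCoshSeries]; linear_combination -sinSeries K * C i * h4
  rw [mul_add (sinCoshSeries K) (systemCoeffFst _ _ * _), mul_left_comm (sinCoshSeries K),
    mul_left_comm (sinCoshSeries K), e1, e2]
  simp only [smul_eq_C_mul] at h1 h2 h1' h2'
  refine thetaChoose_eq_of_system ?_ ?_ hd
  · rw [smul_eq_C_mul, smul_eq_C_mul]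
    simp only [map_add, map_one, Derivation.leibniz, smul_eq_mul, hCi]
    linear_combination sinSeries K * h2 + coshSeries K * h1 + C i * cosSeries K * h2'
      + C i * sinhSeries K * h1' + X * sinSeries K * sinhSeries K * hC
  · rw [smul_eq_C_mul, smul_eq_C_mul]
    simp only [map_add, map_one, Derivation.leibniz, smul_eq_mul, hCi, hX, map_sub]
    have e2 : (C (2 : K)) = 2 := map_ofNat C 2
    rw [e2] at h1 h2 h1' h2'
    rw [e2]
    linear_combination cosSeries K * h2 + coshSeries K * h1'
      - C i * X * sinSeries K * h2' - C i * X * sinhSeries K * h1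
      + X * cosSeries K * sinhSeries K * hC

/-- The quotient of `X ^ d / d! · (d/dX) ^ d P` by `P`, for `P = sin u cosh u / u`, in terms of
`cot` and `tanh` with polynomial coefficients. It is the mean of
`thetaChoose_sinCoshSeries_mul` for `i` and for `-i`. -/
theorem two_smul_thetaChoose_sinCoshSeries {i : K} (hi : i ^ 2 = -1) {d : ℕ} (hd : 1 ≤ d) :
    (2 : K) • thetaChoose d (sinCoshSeries K) = sinCoshSeries K *
      ((systemCoeffFst (1 + i) d + systemCoeffFst (1 - i) d)
        + C i * (systemCoeffFst (1 + i) d - systemCoeffFst (1 - i) d)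
          * (cotSeries K * tanhQuotSeries K)
        + (systemCoeffSnd (1 + i) d + systemCoeffSnd (1 - i) d) * cotSeries K
        - C i * (systemCoeffSnd (1 + i) d - systemCoeffSnd (1 - i) d) * tanhSeries K) := by
  have h1 := thetaChoose_sinCoshSeries_mul hi hd
  have h2 := thetaChoose_sinCoshSeries_mul (i := -i) (by simpa using hi) hd
  have h3 := congrArg₂ (· + ·) h1 h2
  simp only [← thetaChoose_add, ← sub_eq_add_neg] at h3
  have e : sinCoshSeries K * (1 + C i * (cotSeries K * tanhQuotSeries K)) +
      sinCoshSeries K * (1 + C (-i) * (cotSeries K * tanhQuotSeries K)) =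
      sinCoshSeries K + sinCoshSeries K := by rw [map_neg]; ring
  rw [e, thetaChoose_add] at h3
  rw [two_smul, h3, map_neg]
  ring

end Trigonometric

/-! ### Symmetric functions of geometric series -/

section GeometricTail

variable {K : Type*} [Field K]

/-- The power series `a X / (1 - a X) = ∑_{s ≥ 1} a ^ s X ^ s`. -/
noncomputable def geomTail (a : K) : K⟦X⟧ := mk fun s => if s = 0 then 0 else a ^ s

lemma geomTail_mul (a : K) : geomTail a * (1 - C a * X) = C a * X := by
  rw [mul_sub, mul_one, mul_left_comm, sub_eq_iff_eq_add]
  ext k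
  rcases k with _ | _ | k
  · simp [geomTail]
  · rw [map_add, coeff_C_mul, coeff_C_mul, coeff_succ_mul_X]
    simp [geomTail]
  · rw [map_add, coeff_C_mul, coeff_C_mul, coeff_succ_mul_X, coeff_X]
    simp [geomTail, pow_succ']

/-- The `d`-th elementary symmetric function of the series `a X / (1 - a X)`, multiplied by the
product of the `1 - a X`. -/
theorem esymm_geomTail_mul_prod {ι : Type*} [DecidableEq ι] (a : ι → K) (S : Finset ι) (d : ℕ) :
    (∑ A ∈ S.powersetCard d, ∏ k ∈ A, geomTail (a k)) * ∏ k ∈ S, (1 - C (a k) * X) =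
      C ((-1) ^ d) * thetaChoose d (∏ k ∈ S, (1 - C (a k) * X)) := by
  induction S using Finset.induction_on generalizing d with
  | empty =>
    rcases d with _ | d
    · simp [thetaChoose_zero]
    · have : thetaChoose (d + 1) (1 : K⟦X⟧) = 0 := by
        ext k
        rcases k with _ | k
        · simp only [coeff_thetaChoose]; simp
        · simp [coeff_one]
      rw [prod_empty, this, powersetCard_eq_empty.mpr (by simp)]
      simp
  | insert x S hx ih =>
    rcases d with _ | d
    · simp [thetaChoose_zero]
    · rw [powersetCard_succ_insert hx, sum_union, sum_image, prod_insert hx,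
        mul_comm (1 - C (a x) * X), thetaChoose_succ_mul_linear]
      · have h1 : ∑ A ∈ S.powersetCard d, ∏ k ∈ insert x A, geomTail (a k) =
            geomTail (a x) * ∑ A ∈ S.powersetCard d, ∏ k ∈ A, geomTail (a k) := by
          rw [mul_sum]
          refine sum_congr rfl fun A hA => prod_insert fun h => hx ?_
          exact (mem_powersetCard.mp hA).1 h
        have i1 := ih (d + 1)
        have i0 := ih d
        have hg := geomTail_mul (a x)
        rw [h1]
        rw [pow_succ, map_mul, map_neg, map_one] at i1 ⊢
        generalize (∏ k ∈ S, (1 - C (a k) * X)) = P at *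
        generalize (∑ A ∈ S.powersetCard d, ∏ k ∈ A, geomTail (a k)) = E at *
        linear_combination (1 - C (a x) * X) * i1 + C (a x) * X * i0 + E * P * hg
      · intro A hA B hB h
        have hA' : x ∉ A := fun h => hx ((mem_powersetCard.mp hA).1 h)
        have hB' : x ∉ B := fun h => hx ((mem_powersetCard.mp hB).1 h)
        rw [← erase_insert hA', ← erase_insert hB', h]
      · rw [disjoint_left]
        intro A hA hA'
        obtain ⟨B, _, rfl⟩ := mem_image.mp hA'
        exact hx ((mem_powersetCard.mp hA).1 (mem_insert_self x B))

end GeometricTail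

/-! ### Convergence of Euler sums -/

section Convergence

/-- Absolute convergence: the general term is dominated by `∏ i, 1 / n_i ^ 2`. -/
lemma hasEulerSum_eulerSum {d : ℕ} {s : Fin d → ℕ} (ε : Fin d → ℤˣ) (hs : ∀ i, 2 ≤ s i) :
    HasEulerSum s ε (eulerSum s ε) := by
  classical
  let g : (Fin d → ℕ) → ℝ := fun n => if ∀ i j : Fin d, i < j → n j < n i then
    ∏ i, ((ε i : ℤ) : ℝ) ^ n i / (n i : ℝ) ^ s i else 0
  have hle (k m : ℕ) (e : ℤˣ) (hm : 2 ≤ m) :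
      |((e : ℤ) : ℝ) ^ k / (k : ℝ) ^ m| ≤ 1 / (k : ℝ) ^ 2 := by
    have he : |((e : ℤ) : ℝ)| = 1 := by rcases Int.units_eq_one_or e with rfl | rfl <;> simp
    rw [abs_div, abs_pow, he, one_pow, abs_of_nonneg (by positivity)]
    rcases Nat.eq_zero_or_pos k with rfl | hk
    · simp [show m ≠ 0 by omega]
    · have : (1 : ℝ) ≤ k := by exact_mod_cast hk
      gcongr
  have hsum2 : Summable fun k : ℕ => 1 / (k : ℝ) ^ 2 :=
    Real.summable_one_div_nat_pow.mpr one_lt_two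
  have hg : Summable fun n => |g n| := by
    refine summable_of_sum_le (c := (∑' k : ℕ, 1 / (k : ℝ) ^ 2) ^ d) (fun _ => abs_nonneg _) ?_
    intro u
    obtain ⟨M, hM⟩ : ∃ M, u ⊆ Fintype.piFinset fun _ : Fin d => range M := by
      refine ⟨u.sup (fun n => univ.sup n) + 1, fun n hn => ?_⟩
      rw [Fintype.mem_piFinset]
      intro i
      rw [mem_range]
      have h1 : n i ≤ univ.sup n := le_sup (f := n) (mem_univ i)
      have h2 : univ.sup n ≤ u.sup (fun n => univ.sup n) :=
        le_sup (f := fun n : Fin d → ℕ => univ.sup n) hn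
      omega
    calc ∑ n ∈ u, |g n|
        ≤ ∑ n ∈ Fintype.piFinset fun _ : Fin d => range M, |g n| :=
          sum_le_sum_of_subset_of_nonneg hM fun _ _ _ => abs_nonneg _
      _ ≤ ∑ n ∈ Fintype.piFinset fun _ : Fin d => range M, ∏ i, 1 / (n i : ℝ) ^ 2 := by
          refine sum_le_sum fun n _ => ?_
          simp only [g]
          split_ifs
          · rw [abs_prod]
            exact prod_le_prod (fun _ _ => abs_nonneg _) fun i _ => hle _ _ _ (hs i)
          · rw [abs_zero]; positivity
      _ = ∏ _i : Fin d, ∑ k ∈ range M, 1 / (k : ℝ) ^ 2 := by rw [prod_univ_sum]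
      _ ≤ (∑' k : ℕ, 1 / (k : ℝ) ^ 2) ^ d := by
          rw [prod_const, card_univ, Fintype.card_fin]
          gcongr
          exact hsum2.sum_le_tsum _ fun _ _ => by positivity
  have htr (N : ℕ) : truncEulerSum s ε N =
      ∑ n ∈ Fintype.piFinset fun _ : Fin d => range (N + 1), g n := by
    rw [truncEulerSum, sum_filter]
    refine sum_subset (fun n => ?_) fun n hn hn' => ?_
    · simp only [Fintype.mem_piFinset, mem_Icc, mem_range]
      intro h i
      have := h i
      omega
    · simp only [Fintype.mem_piFinset, mem_Icc, mem_range, not_forall] at hn hn'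
      obtain ⟨i, hi⟩ := hn'
      have h0 : n i = 0 := by have := hn i; omega
      rw [ite_eq_right_iff]
      intro _
      refine prod_eq_zero (mem_univ i) ?_
      rw [h0, Nat.cast_zero, zero_pow (by have := hs i; omega), div_zero]
  have hlim : Tendsto (truncEulerSum s ε) atTop (𝓝 (∑' n, g n)) := by
    rw [funext htr]
    refine (Summable.hasSum hg.of_abs).comp (tendsto_atTop_finset_of_monotone ?_ ?_)
    · intro a b hab
      exact Fintype.piFinset_subset _ _ fun _ => range_subset_range.mpr (by omega)
    · intro n
      refine ⟨univ.sup n, ?_⟩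
      rw [Fintype.mem_piFinset]
      intro i
      exact mem_range.mpr (Nat.lt_succ_of_le (le_sup (f := n) (mem_univ i)))
  rw [HasEulerSum, eulerSum, hlim.limUnder_eq]
  exact hlim

lemma truncEulerSum_one (m : ℕ) (e : ℤˣ) (N : ℕ) :
    truncEulerSum (fun _ : Fin 1 => m) (fun _ => e) N =
      ∑ k ∈ Icc 1 N, ((e : ℤ) : ℝ) ^ k / (k : ℝ) ^ m := by
  rw [truncEulerSum]
  refine sum_nbij' (fun n => n 0) (fun k _ => k) ?_ ?_ ?_ ?_ ?_
  · intro n hn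
    exact Fintype.mem_piFinset.mp (mem_filter.mp hn).1 0
  · intro k hk
    refine mem_filter.mpr ⟨Fintype.mem_piFinset.mpr fun _ => hk, fun i j hij => ?_⟩
    exact absurd hij (by simp [Subsingleton.elim i j])
  · intro n _
    funext i
    rw [Subsingleton.elim i 0]
  · simp
  · simp

lemma tendsto_sum_one_div_pow {m : ℕ} (hm : 2 ≤ m) :
    Tendsto (fun N : ℕ => ∑ k ∈ Icc 1 N, 1 / (k : ℂ) ^ m) atTop (𝓝 (riemannZeta m)) := by
  have hs : Summable fun k : ℕ => 1 / (k : ℂ) ^ m :=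
    .of_norm (by simpa using Real.summable_one_div_nat_pow.mpr (show 1 < m from hm))
  rw [zeta_nat_eq_tsum_of_gt_one hm]
  refine ((tendsto_add_atTop_iff_nat 1).mpr hs.hasSum.tendsto_sum_nat).congr fun N => ?_
  rw [range_eq_Ico, sum_eq_sum_Ico_succ_bot (Nat.succ_pos N), Nat.cast_zero,
    zero_pow (by omega), div_zero, zero_add]
  rfl

lemma tendsto_sum_neg_one_pow_div_pow {m : ℕ} (hm : 2 ≤ m) :
    Tendsto (fun N : ℕ => ∑ k ∈ Icc 1 N, (-1 : ℂ) ^ k / (k : ℂ) ^ m) atTop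
      (𝓝 (zetaBar m : ℂ)) := by
  have h := (Complex.continuous_ofReal.tendsto _).comp
    (hasEulerSum_eulerSum (s := fun _ : Fin 1 => m) (fun _ => -1) fun _ => hm)
  refine h.congr fun N => ?_
  simp [truncEulerSum_one]

/-- Splitting off the terms of even index evaluates the alternating zeta value. -/
lemma zetaBar_eq {m : ℕ} (hm : 2 ≤ m) :
    (zetaBar m : ℂ) = ((2 : ℂ) ^ (1 - (m : ℤ)) - 1) * riemannZeta (m : ℂ) := by
  have hN (N : ℕ) : ∑ k ∈ Icc 1 (2 * N), (-1 : ℂ) ^ k / (k : ℂ) ^ m =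
      (2 : ℂ) ^ (1 - (m : ℤ)) * ∑ k ∈ Icc 1 N, 1 / (k : ℂ) ^ m -
        ∑ k ∈ Icc 1 (2 * N), 1 / (k : ℂ) ^ m := by
    induction N with
    | zero => simp
    | succ N ih =>
      rw [show 2 * (N + 1) = 2 * N + 1 + 1 by ring, sum_Icc_succ_top (by omega),
        sum_Icc_succ_top (by omega), ih, sum_Icc_succ_top (by omega), sum_Icc_succ_top (by omega),
        sum_Icc_succ_top (by omega)]
      have e1 : (-1 : ℂ) ^ (2 * N) = 1 := by rw [pow_mul]; simp
      have e2 : ((2 * N + 1 + 1 : ℕ) : ℂ) = 2 * ((N + 1 : ℕ) : ℂ) := by push_cast; ring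
      have e3 : (2 : ℂ) ^ (1 - (m : ℤ)) = 2 / 2 ^ m := by
        rw [zpow_sub₀ two_ne_zero, zpow_one, zpow_natCast]
      rw [pow_succ (-1 : ℂ) (2 * N + 1), pow_succ (-1 : ℂ) (2 * N), e1, e2, mul_pow, e3, mul_add]
      have : ((N + 1 : ℕ) : ℂ) ≠ 0 := by exact_mod_cast Nat.succ_ne_zero N
      field_simp
      ring
  have hz := tendsto_sum_one_div_pow hm
  have h2 : Tendsto (fun N : ℕ => 2 * N) atTop atTop :=
    tendsto_id.const_mul_atTop' two_pos
  have hlim := ((hz.const_mul ((2 : ℂ) ^ (1 - (m : ℤ)))).sub (hz.comp h2))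
  have := tendsto_nhds_unique ((tendsto_sum_neg_one_pow_div_pow hm).comp h2)
    (hlim.congr fun N => (hN N).symm)
  rw [this]
  ring

end Convergence

/-! ### The generating function of the sums over compositions -/

section GeneratingFunction

/-- The numbers `(-1) ^ k / k ^ 2`. -/
noncomputable def altInvSq (k : ℕ) : ℂ := (-1) ^ k / (k : ℂ) ^ 2

lemma mem_comps {n d : ℕ} {s : Fin d → ℕ} :
    s ∈ comps n d ↔ ∑ i, s i = n ∧ ∀ i, 0 < s i := by
  simp [comps, Finset.Nat.mem_antidiagonalTuple]

/-- The coefficients of a product of series `geomTail`, as a sum over compositions. -/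
lemma coeff_prod_geomTail {K : Type*} [Field K] {d : ℕ} (b : Fin d → K) (n : ℕ) :
    coeff n (∏ i, geomTail (b i)) = ∑ s ∈ comps n d, ∏ i, b i ^ s i := by
  classical
  rw [coeff_prod]
  have h : ∑ l ∈ finsuppAntidiag (univ : Finset (Fin d)) n, ∏ i, coeff (l i) (geomTail (b i)) =
      ∑ s ∈ Finset.Nat.antidiagonalTuple d n, ∏ i, coeff (s i) (geomTail (b i)) := by
    refine sum_nbij' (fun l => ⇑l) (fun s => Finsupp.equivFunOnFinite.symm s) ?_ ?_ ?_ ?_ ?_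
    · intro l hl
      rw [Finset.Nat.mem_antidiagonalTuple]
      exact (mem_finsuppAntidiag.mp hl).1
    · intro s hs
      rw [mem_finsuppAntidiag]
      exact ⟨by simpa using Finset.Nat.mem_antidiagonalTuple.mp hs, subset_univ _⟩
    · intro l _; ext i; rfl
    · intro s _; rfl
    · intro l _; rfl
  rw [h, comps, sum_filter]
  refine sum_congr rfl fun s _ => ?_
  split_ifs with hs
  · exact prod_congr rfl fun i _ => by simp [geomTail, (hs i).ne']
  · push Not at hs
    obtain ⟨i, hi⟩ := hs
    exact prod_eq_zero (mem_univ i) (by simp [geomTail, Nat.le_zero.mp hi])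

/-- Sums over subsets of size `d` as sums over strictly decreasing `d`-tuples. -/
lemma sum_powersetCard_prod {R : Type*} [CommSemiring R] (f : ℕ → R) (S : Finset ℕ) (d : ℕ) :
    ∑ A ∈ S.powersetCard d, ∏ k ∈ A, f k =
      ∑ n ∈ (Fintype.piFinset fun _ : Fin d => S).filter
        (fun n => ∀ i j : Fin d, i < j → n j < n i), ∏ i, f (n i) := by
  symm
  refine sum_nbij (fun n => univ.image n) ?_ ?_ ?_ ?_
  · intro n hn
    obtain ⟨h1, h2⟩ := mem_filter.mp hn
    have hanti : StrictAnti n := fun i j hij => h2 i j hij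
    rw [mem_powersetCard, card_image_of_injective _ hanti.injective, card_univ, Fintype.card_fin]
    exact ⟨image_subset_iff.mpr fun i _ => Fintype.mem_piFinset.mp h1 i, rfl⟩
  · intro n hn m hm h
    have h1 : StrictAnti n := fun i j hij => (mem_filter.mp hn).2 i j hij
    have h2 : StrictAnti m := fun i j hij => (mem_filter.mp hm).2 i j hij
    have hr : Set.range n = Set.range m := by
      have := congrArg (fun A : Finset ℕ => (A : Set ℕ)) h
      simpa using this
    -- reversal of the index makes both tuples strictly monotone, so that the range determines them
    have h1' : StrictMono (n ∘ Fin.rev) := fun i j hij => h1 (Fin.rev_lt_rev.mpr hij)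
    have h2' : StrictMono (m ∘ Fin.rev) := fun i j hij => h2 (Fin.rev_lt_rev.mpr hij)
    have hrev : n ∘ Fin.rev = m ∘ Fin.rev := by
      refine (StrictMono.range_inj h1' h2').mp ?_
      rw [Fin.rev_surjective.range_comp, Fin.rev_surjective.range_comp, hr]
    funext i
    simpa using congrFun hrev i.rev
  · intro A hA
    obtain ⟨h1, h2⟩ := mem_powersetCard.mp (mem_coe.mp hA)
    refine ⟨fun i => A.orderEmbOfFin h2 i.rev, ?_, ?_⟩
    · refine mem_coe.mpr (mem_filter.mpr ⟨Fintype.mem_piFinset.mpr fun i => ?_, fun i j hij => ?_⟩)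
      · exact h1 (orderEmbOfFin_mem A h2 _)
      · exact (A.orderEmbOfFin h2).strictMono (Fin.rev_lt_rev.mpr hij)
    · rw [← coe_inj, coe_image, coe_univ, Set.image_univ]
      have := Fin.rev_surjective.range_comp (A.orderEmbOfFin h2) (ι := Fin d)
      rw [range_orderEmbOfFin] at this
      exact this
  · intro n hn
    have h1 : StrictAnti n := fun i j hij => (mem_filter.mp hn).2 i j hij
    rw [prod_image h1.injective.injOn]

lemma sum_truncEulerSum_eq_coeff (n d N : ℕ) :
    ((∑ s ∈ comps n d, truncEulerSum (fun i => 2 * s i) (fun i => (-1) ^ s i) N : ℝ) : ℂ) =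
      coeff n (∑ A ∈ (Icc 1 N).powersetCard d, ∏ k ∈ A, geomTail (altInvSq k)) := by
  rw [sum_powersetCard_prod, map_sum]
  simp only [coeff_prod_geomTail, truncEulerSum]
  rw [sum_comm]
  push_cast
  refine sum_congr rfl fun m _ => sum_congr rfl fun s _ => prod_congr rfl fun i _ => ?_
  simp only [altInvSq, div_pow, ← pow_mul]
  rw [mul_comm (s i)]

lemma hasEulerSum_xi {n d : ℕ} {s : Fin d → ℕ} (hs : s ∈ comps n d) :
    HasEulerSum (fun i => 2 * s i) (fun i => (-1) ^ s i) (xi s) :=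
  hasEulerSum_eulerSum _ fun i => by have := (mem_comps.mp hs).2 i; omega

lemma tendsto_coeff_esymm (n d : ℕ) :
    Tendsto (fun N => coeff n (∑ A ∈ (Icc 1 N).powersetCard d, ∏ k ∈ A, geomTail (altInvSq k)))
      atTop (𝓝 (Xi n d : ℂ)) := by
  have h : Tendsto (fun N => ∑ s ∈ comps n d,
      truncEulerSum (fun i => 2 * s i) (fun i => (-1) ^ s i) N) atTop (𝓝 (Xi n d)) :=
    tendsto_finsetSum _ fun s hs => hasEulerSum_xi hs
  exact ((Complex.continuous_ofReal.tendsto _).comp h).congr fun N =>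
    sum_truncEulerSum_eq_coeff n d N

lemma Xi_zero_one : Xi 0 1 = 0 := by
  have : comps 0 1 = ∅ := by
    refine eq_empty_of_forall_notMem fun s hs => ?_
    obtain ⟨h1, h2⟩ := mem_comps.mp hs
    have := h2 0
    simp at h1
    omega
  rw [Xi, this, sum_empty]

lemma Xi_one {n : ℕ} (hn : 1 ≤ n) : (Xi n 1 : ℂ) = zetaTilde n (2 * n) := by
  have h := tendsto_coeff_esymm n 1
  have hN (N : ℕ) : coeff n (∑ A ∈ (Icc 1 N).powersetCard 1, ∏ k ∈ A, geomTail (altInvSq k)) =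
      ∑ k ∈ Icc 1 N, altInvSq k ^ n := by
    rw [powersetCard_one, sum_map, map_sum]
    refine sum_congr rfl fun k _ => ?_
    simp [geomTail, show n ≠ 0 by omega]
  simp only [hN] at h
  refine tendsto_nhds_unique h ?_
  rw [zetaTilde]
  split_ifs with hp
  · refine (tendsto_sum_one_div_pow (show 2 ≤ 2 * n by omega)).congr fun N => ?_
    refine sum_congr rfl fun k _ => ?_
    rw [altInvSq, div_pow, ← pow_mul, ← pow_mul, mul_comm k, pow_mul (-1 : ℂ), hp.neg_one_pow,
      one_pow]
  · refine (tendsto_sum_neg_one_pow_div_pow (show 2 ≤ 2 * n by omega)).congr fun N => ?_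
    refine sum_congr rfl fun k _ => ?_
    rw [altInvSq, div_pow, ← pow_mul, ← pow_mul, mul_comm k, pow_mul (-1 : ℂ),
      (Nat.not_even_iff_odd.mp hp).neg_one_pow]

/-- The generating function of `Ξ(2n, d)` for fixed `d`. -/
noncomputable def XiSeries (d : ℕ) : ℂ⟦X⟧ := mk fun n => (Xi n d : ℂ)

end GeneratingFunction

/-! ### Passage to the limit -/

section Limit

lemma coeff_cotSeries (s : ℕ) :
    coeff s (cotSeries ℂ) = -2 * riemannZeta (2 * (s : ℂ)) / (Real.pi : ℂ) ^ (2 * s) := by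
  rw [riemannZeta_two_mul_nat', cotSeries, coeff_mk]
  have hpi : (Real.pi : ℂ) ≠ 0 := by exact_mod_cast Real.pi_ne_zero
  have h2 : (2 : ℂ) ^ (2 * (s : ℤ) - 1) = 4 ^ s / 2 := by
    rw [zpow_sub₀ two_ne_zero, zpow_one, zpow_mul, zpow_natCast]; norm_num
  have e1 : (-4 : ℂ) ^ s = (-1) ^ s * 4 ^ s := by rw [← mul_pow]; norm_num
  have h0 : ((2 * s).factorial : ℂ) ≠ 0 := by exact_mod_cast Nat.factorial_ne_zero _
  rw [h2, e1]
  field_simp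
  ring

lemma coeff_tanhSeries (s : ℕ) :
    coeff s (tanhSeries ℂ) = (-1) ^ s * (4 ^ s - 1) * coeff s (cotSeries ℂ) := by
  rw [tanhSeries, map_sub, coeff_rescale, coeff_rescale]
  ring

lemma coeff_cotSeries_mul_tanhSeries (k : ℕ) :
    coeff k (cotSeries ℂ * tanhSeries ℂ) = 4 * 4 ^ k / (Real.pi : ℂ) ^ (2 * k) * zetaConv k := by
  have hpi : (Real.pi : ℂ) ≠ 0 := by exact_mod_cast Real.pi_ne_zero
  rw [mul_comm, coeff_mul, zetaConv, mul_sum]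
  refine sum_congr rfl fun p hp => ?_
  rw [coeff_tanhSeries, coeff_cotSeries, coeff_cotSeries, ← mem_antidiagonal.mp hp, mul_add,
    pow_add (Real.pi : ℂ)]
  field_simp
  ring

lemma zetaTilde_two_mul (n : ℕ) {s : ℕ} (hs : 1 ≤ s) :
    zetaTilde n (2 * s) * 4 ^ s =
      riemannZeta (2 * (s : ℂ)) * (1 + (-1) ^ n * (4 ^ s - 1)) := by
  rw [zetaTilde]
  split_ifs with h
  · rw [h.neg_one_pow]; push_cast; ring
  · rw [(Nat.not_even_iff_odd.mp h).neg_one_pow, zetaBar_eq (by omega)]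
    have h2 : (2 : ℂ) ^ (1 - ((2 * s : ℕ) : ℤ)) = 2 / 4 ^ s := by
      rw [zpow_sub₀ two_ne_zero, zpow_one, zpow_natCast, pow_mul]; norm_num
    rw [h2]
    push_cast
    field_simp
    ring

/-- The power series of `sin u cosh u / u` for `u ^ 2 = π ^ 2 X / 4`. By `tendsto_coeff_prod` it is
the infinite product of the `1 - (-1) ^ k X / k ^ 2`. -/
noncomputable def prodSeries : ℂ⟦X⟧ := rescale ((Real.pi : ℂ) ^ 2 / 4) (sinCoshSeries ℂ)

lemma coeff_zero_prodSeries : coeff 0 prodSeries = 1 := by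
  rw [prodSeries, coeff_rescale, coeff_zero_sinCoshSeries]; simp

lemma prodSeries_ne_zero : prodSeries ≠ 0 := fun h => by
  have := coeff_zero_prodSeries; rw [h] at this; simp at this

lemma XiSeries_one : C (2 : ℂ) * XiSeries 1 =
    -rescale ((Real.pi : ℂ) ^ 2 / 4) (cotSeries ℂ - 1 + tanhSeries ℂ) := by
  have hpi : (Real.pi : ℂ) ≠ 0 := by exact_mod_cast Real.pi_ne_zero
  ext n
  rw [coeff_C_mul, map_neg, coeff_rescale, map_add, map_sub, coeff_tanhSeries, XiSeries, coeff_mk]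
  rcases n with _ | n
  · rw [Xi_zero_one, coeff_cotSeries]
    simp [riemannZeta_zero]
    norm_num
  · have h := zetaTilde_two_mul (n + 1) (show 1 ≤ n + 1 by omega)
    rw [Xi_one (by omega), coeff_cotSeries, coeff_one, if_neg (Nat.succ_ne_zero n), div_pow,
      ← pow_mul]
    have h4 : (4 : ℂ) ^ (n + 1) ≠ 0 := pow_ne_zero _ (by norm_num)
    rw [eq_div_of_mul_eq h4 h]
    field_simp
    ring

/-- Newton's identity for `prodSeries`. -/
lemma XiSeries_one_mul_prodSeries : XiSeries 1 * prodSeries = -theta prodSeries := by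
  have h := congrArg (rescale ((Real.pi : ℂ) ^ 2 / 4)) (two_smul_theta_sinCoshSeries ℂ)
  rw [smul_eq_C_mul, map_mul, rescale_C, ← theta_rescale, map_mul] at h
  refine mul_left_cancel₀ (show C (2 : ℂ) ≠ 0 by simp) ?_
  rw [← mul_assoc, XiSeries_one, prodSeries]
  linear_combination h

/-- The coefficients of the finite products converge: Newton's identity expresses them
recursively by power sums, whose limits are known. -/
lemma tendsto_coeff_prod (j : ℕ) :
    Tendsto (fun N => coeff j (∏ k ∈ Icc 1 N, (1 - C (altInvSq k) * X))) atTop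
      (𝓝 (coeff j prodSeries)) := by
  induction j using Nat.strong_induction_on with
  | _ j ih =>
  rcases j with _ | j
  · rw [coeff_zero_prodSeries]
    refine tendsto_const_nhds.congr fun N => ?_
    simp [map_prod]
  · have hj : (j + 1 : ℂ) ≠ 0 := by exact_mod_cast Nat.succ_ne_zero j
    have newton (E P : ℂ⟦X⟧) (h : E * P = -theta P) (h0 : coeff 0 E = 0) :
        coeff (j + 1) P =
          -(∑ p ∈ antidiagonal j, coeff (p.1 + 1) E * coeff p.2 P) / (j + 1) := by
      have := congrArg (coeff (j + 1)) h
      rw [coeff_mul, Nat.sum_antidiagonal_succ, h0, zero_mul, zero_add, map_neg,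
        coeff_theta] at this
      rw [this]
      push_cast
      field_simp
    rw [newton _ _ XiSeries_one_mul_prodSeries (by
      rw [XiSeries, coeff_mk, Xi_zero_one, Complex.ofReal_zero])]
    have hN (N : ℕ) := newton (∑ A ∈ (Icc 1 N).powersetCard 1, ∏ k ∈ A, geomTail (altInvSq k))
      (∏ k ∈ Icc 1 N, (1 - C (altInvSq k) * X))
      (by rw [esymm_geomTail_mul_prod, thetaChoose_one]; simp)
      (by rw [powersetCard_one, sum_map, map_sum]
          exact sum_eq_zero fun k _ => by simp [geomTail])
    simp only [hN]
    refine (tendsto_finsetSum _ fun p hp => ?_).neg.div_const _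
    have hp' := mem_antidiagonal.mp hp
    refine Tendsto.mul ?_ (ih p.2 (by omega))
    rw [XiSeries, coeff_mk]
    exact tendsto_coeff_esymm _ _

/-- The generating function of `Ξ(2n, d)` is a logarithmic derivative of order `d`. -/
theorem XiSeries_mul_prodSeries (d : ℕ) :
    XiSeries d * prodSeries = C ((-1) ^ d) * thetaChoose d prodSeries := by
  ext n
  have h1 : Tendsto (fun N => coeff n ((∑ A ∈ (Icc 1 N).powersetCard d,
      ∏ k ∈ A, geomTail (altInvSq k)) * ∏ k ∈ Icc 1 N, (1 - C (altInvSq k) * X))) atTop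
      (𝓝 (coeff n (XiSeries d * prodSeries))) := by
    simp only [coeff_mul]
    refine tendsto_finsetSum _ fun p _ => Tendsto.mul ?_ (tendsto_coeff_prod _)
    rw [XiSeries, coeff_mk]
    exact tendsto_coeff_esymm _ _
  refine tendsto_nhds_unique h1 ?_
  simp only [esymm_geomTail_mul_prod, coeff_C_mul, coeff_thetaChoose]
  exact ((tendsto_coeff_prod n).const_mul _).const_mul _

/-- `Ξ(2n, d)` is a rational multiple of `π ^ (2n)`. -/
theorem exists_rat_Xi_eq (n d : ℕ) : ∃ q : ℚ, Xi n d = (q : ℝ) * Real.pi ^ (2 * n) := by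
  have hmap : map (algebraMap ℚ ℂ) (sinCoshSeries ℚ) = sinCoshSeries ℂ := by
    rw [sinCoshSeries, map_mul]
    congr 1 <;> ext k <;> simp [sinSeries, coshSeries, cosSeries, coeff_rescale]
  let R : ℚ⟦X⟧ := C ((-1) ^ d) * thetaChoose d (sinCoshSeries ℚ) * (sinCoshSeries ℚ)⁻¹
  have hR : R * sinCoshSeries ℚ = C ((-1) ^ d) * thetaChoose d (sinCoshSeries ℚ) := by
    rw [mul_assoc, PowerSeries.inv_mul_cancel, mul_one]
    rw [← coeff_zero_eq_constantCoeff_apply, coeff_zero_sinCoshSeries]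
    exact one_ne_zero
  have hXi : XiSeries d = rescale ((Real.pi : ℂ) ^ 2 / 4) (map (algebraMap ℚ ℂ) R) := by
    refine mul_right_cancel₀ prodSeries_ne_zero ?_
    rw [XiSeries_mul_prodSeries, prodSeries, ← hmap, ← map_mul, ← map_mul, hR, map_mul, map_C,
      thetaChoose_map, map_mul, rescale_C, thetaChoose_rescale]
    simp
  refine ⟨coeff n R / 4 ^ n, ?_⟩
  have := congrArg (coeff n) hXi
  rw [XiSeries, coeff_mk, coeff_rescale, coeff_map, eq_ratCast, div_pow, ← pow_mul] at this
  have h2 : (Xi n d : ℂ) = (((coeff n R / 4 ^ n : ℚ) : ℝ) * Real.pi ^ (2 * n) : ℝ) := by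
    rw [this]; push_cast; ring
  exact_mod_cast h2

end Limit

/-! ### Comparison of coefficients -/

section Coefficients

lemma one_add_I_pow (j : ℕ) :
    (1 + Complex.I) ^ (2 * j + 1) = 2 ^ j * (-1) ^ (j / 2) * ((-1) ^ j + Complex.I) := by
  have h2 : (1 + Complex.I) ^ 2 = 2 * Complex.I := by linear_combination Complex.I_sq
  have h4 : (2 * Complex.I) ^ 2 = -4 := by linear_combination 4 * Complex.I_sq
  rcases Nat.even_or_odd' j with ⟨t, rfl | rfl⟩
  · rw [pow_succ, pow_mul, h2, pow_mul, h4, Nat.mul_div_cancel_left _ two_pos, pow_mul 2,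
      pow_mul (-1) 2 t, show (-4 : ℂ) = 2 ^ 2 * -1 by norm_num, mul_pow]
    simp
  · rw [pow_succ, pow_mul, h2, pow_succ _ (2 * t), pow_mul, h4, show (2 * t + 1) / 2 = t by omega,
      pow_succ 2, pow_mul 2, pow_succ _ (2 * t), pow_mul (-1) 2 t,
      show (-4 : ℂ) = 2 ^ 2 * -1 by norm_num, mul_pow]
    simp
    linear_combination 2 * 4 ^ t * (-1) ^ t * Complex.I_sq

lemma one_sub_I_pow (j : ℕ) :
    (1 - Complex.I) ^ (2 * j + 1) = 2 ^ j * (-1) ^ (j / 2) * ((-1) ^ j - Complex.I) := by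
  have := congrArg (starRingEnd ℂ) (one_add_I_pow j)
  simpa [← sub_eq_add_neg, Complex.conj_ofNat] using this

lemma coeff_systemCoeffFst_sub (d m : ℕ) :
    coeff m (C Complex.I * (systemCoeffFst (1 + Complex.I) d - systemCoeffFst (1 - Complex.I) d)) =
      (if Even m then 0 else (-1) ^ (m / 2)) * (-(-1) ^ d * (-8) ^ m * 2 *
        ((2 * d - 2 * m).choose d : ℂ) / ((2 * m).factorial * 4 ^ d)) := by
  have h2 : (1 + Complex.I) ^ 2 = 2 * Complex.I := by linear_combination Complex.I_sq
  have h2' : (1 - Complex.I) ^ 2 = 2 * -Complex.I := by linear_combination Complex.I_sq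
  have key : Complex.I * ((1 + Complex.I) ^ (2 * m) - (1 - Complex.I) ^ (2 * m)) =
      (if Even m then 0 else (-1) ^ (m / 2)) * (-2 * 2 ^ m) := by
    rw [pow_mul, pow_mul, h2, h2', mul_pow, mul_pow]
    split_ifs with h
    · rw [h.neg_pow]; ring
    · obtain ⟨t, rfl⟩ := Nat.not_even_iff_odd.mp h
      rw [(odd_two_mul_add_one t).neg_pow, show (2 * t + 1) / 2 = t by omega, pow_succ Complex.I,
        pow_mul Complex.I, Complex.I_sq]
      linear_combination 2 * 2 ^ (2 * t + 1) * (-1) ^ t * Complex.I_sq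
  have h8 : (-8 : ℂ) ^ m = (-4) ^ m * 2 ^ m := by rw [← mul_pow]; norm_num
  rw [coeff_C_mul, map_sub, systemCoeffFst, systemCoeffFst, coeff_mk, coeff_mk, h8]
  linear_combination (-1) ^ d * (-4) ^ m * ((2 * d - 2 * m).choose d : ℂ) /
    ((2 * m).factorial * 4 ^ d) * key

lemma coeff_systemCoeffSnd_add (d j : ℕ) :
    coeff j (systemCoeffSnd (1 + Complex.I) d + systemCoeffSnd (1 - Complex.I) d) =
      -(-1) ^ d * 4 * 8 ^ j * (-1) ^ (j / 2) * ((2 * d - 2 * j - 1).choose d : ℂ) /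
        ((2 * j + 1).factorial * 4 ^ d) := by
  have h8 : (8 : ℂ) ^ j = (-4) ^ j * 2 ^ j * (-1) ^ j := by
    rw [← mul_pow, ← mul_pow]; norm_num
  rw [map_add, systemCoeffSnd, systemCoeffSnd, coeff_mk, coeff_mk, one_add_I_pow, one_sub_I_pow, h8]
  ring

lemma coeff_systemCoeffSnd_sub (d j : ℕ) :
    coeff j (C Complex.I *
        (systemCoeffSnd (1 + Complex.I) d - systemCoeffSnd (1 - Complex.I) d)) =
      -(-1) ^ j *
        coeff j (systemCoeffSnd (1 + Complex.I) d + systemCoeffSnd (1 - Complex.I) d) := by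
  have h1 : ((-1 : ℂ) ^ j) ^ 2 = 1 := by rw [← pow_mul, mul_comm, pow_mul]; simp
  have h8 : (8 : ℂ) ^ j = (-4) ^ j * 2 ^ j * (-1) ^ j := by
    rw [← mul_pow, ← mul_pow]; norm_num
  rw [coeff_systemCoeffSnd_add, coeff_C_mul, map_sub, systemCoeffSnd, systemCoeffSnd, coeff_mk,
    coeff_mk, one_add_I_pow, one_sub_I_pow, h8]
  linear_combination (-1) ^ d * 4 * (-4) ^ j * 2 ^ j * (-1) ^ (j / 2) *
    ((2 * d - 2 * j - 1).choose d : ℂ) / ((2 * j + 1).factorial * 4 ^ d) * (-h1 - Complex.I_sq)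

/-- The contribution of the products of `cot` and `tanh`. -/
lemma coeff_cot_tanh_part {n d : ℕ} (hd : 1 ≤ d) (hdn : d ≤ n) :
    coeff n (C Complex.I * (systemCoeffFst (1 + Complex.I) d - systemCoeffFst (1 - Complex.I) d)
        * (cotSeries ℂ * tanhQuotSeries ℂ)) =
      ∑ j ∈ range ((d + 2) / 4), 64 * (-1) ^ d * (-64) ^ j * 4 ^ (n - 2 * j) /
        (Real.pi : ℂ) ^ (2 * (n - 2 * j)) * zetaConv (n - 2 * j) *
        ((2 * d - 4 * j - 2).choose d : ℂ) / ((4 * j + 2).factorial * 4 ^ d) := by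
  rw [coeff_mul, Nat.sum_antidiagonal_eq_sum_range_succ_mk]
  symm
  refine sum_of_injOn (fun j => 2 * j + 1) ?_ ?_ ?_ ?_
  · intro a _ b _ h
    simp only at h
    omega
  · intro j hj
    simp only [coe_range, Set.mem_Iio] at hj ⊢
    omega
  · intro m hm hm'
    rw [coeff_systemCoeffFst_sub]
    split_ifs with he
    · simp
    · obtain ⟨t, rfl⟩ := Nat.not_even_iff_odd.mp he
      have ht : ¬ t < (d + 2) / 4 := fun h => hm' ⟨t, by simpa using h, rfl⟩
      rw [Nat.choose_eq_zero_of_lt (by omega)]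
      simp
  · intro j hj
    have hj' := mem_range.mp hj
    have hodd : ¬ Even (2 * j + 1) := by simp
    have hc : coeff (n - (2 * j + 1)) (cotSeries ℂ * tanhQuotSeries ℂ) =
        coeff (n - 2 * j) (cotSeries ℂ * tanhSeries ℂ) := by
      rw [← X_mul_tanhQuotSeries, mul_left_comm,
        show n - 2 * j = n - (2 * j + 1) + 1 by omega, coeff_succ_X_mul]
    rw [hc, coeff_cotSeries_mul_tanhSeries, coeff_systemCoeffFst_sub, if_neg hodd,
      show (2 * j + 1) / 2 = j by omega, show 2 * d - 2 * (2 * j + 1) = 2 * d - 4 * j - 2 by omega,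
      show 2 * (2 * j + 1) = 4 * j + 2 by ring, pow_succ (-8 : ℂ), pow_mul (-8 : ℂ),
      show (-64 : ℂ) ^ j = (-1) ^ j * ((-8) ^ 2) ^ j by rw [← mul_pow]; norm_num]
    ring

/-- The contribution of the terms that are linear in `cot` and `tanh`. -/
lemma coeff_cot_add_tanh_part {n d : ℕ} (hd : 1 ≤ d) (hdn : d ≤ n) :
    coeff n ((systemCoeffSnd (1 + Complex.I) d + systemCoeffSnd (1 - Complex.I) d) * cotSeries ℂ
        - C Complex.I * (systemCoeffSnd (1 + Complex.I) d - systemCoeffSnd (1 - Complex.I) d)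
          * tanhSeries ℂ) =
      ∑ j ∈ range ((d - 1) / 2 + 1), (-1) ^ d * 8 * 8 ^ j * (-1) ^ (j / 2) * 4 ^ (n - j) /
        (Real.pi : ℂ) ^ (2 * (n - j)) * zetaTilde n (2 * n - 2 * j) *
        ((2 * d - 2 * j - 1).choose d : ℂ) / ((2 * j + 1).factorial * 4 ^ d) := by
  rw [map_sub, coeff_mul, coeff_mul, Nat.sum_antidiagonal_eq_sum_range_succ_mk,
    Nat.sum_antidiagonal_eq_sum_range_succ_mk, ← sum_sub_distrib]
  symm
  refine (sum_congr rfl fun j hj => ?_).trans (sum_subset ?_ ?_)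
  · have hj' := mem_range.mp hj
    have hz := zetaTilde_two_mul n (show 1 ≤ n - j by omega)
    have hs : (-1 : ℂ) ^ n = (-1) ^ j * (-1) ^ (n - j) := by
      rw [← pow_add]; congr 1; omega
    rw [coeff_systemCoeffSnd_sub, coeff_systemCoeffSnd_add, coeff_tanhSeries, coeff_cotSeries,
      show 2 * n - 2 * j = 2 * (n - j) by omega]
    rw [hs] at hz
    linear_combination (-1) ^ d * 8 * 8 ^ j * (-1) ^ (j / 2) / (Real.pi : ℂ) ^ (2 * (n - j)) *
      ((2 * d - 2 * j - 1).choose d : ℂ) / ((2 * j + 1).factorial * 4 ^ d) * hz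
  · exact range_subset_range.mpr (by omega)
  · intro j _ hj
    rw [mem_range] at hj
    rw [coeff_systemCoeffSnd_sub, coeff_systemCoeffSnd_add, Nat.choose_eq_zero_of_lt (by omega)]
    simp

/-- The formula for `Ξ(2n, d)`: the coefficient of `X ^ n` in
`two_smul_thetaChoose_sinCoshSeries`. -/
theorem Xi_eq {n d : ℕ} (hd : 1 ≤ d) (hdn : d ≤ n) :
    (Xi n d : ℂ) =
      (∑ j ∈ range ((d - 1) / 2 + 1),
        (-1 : ℂ) ^ (j / 2) * (Real.pi : ℂ) ^ (2 * j) * zetaTilde n (2 * n - 2 * j) /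
          ((2 : ℂ) ^ (2 * (d : ℤ) - (j : ℤ) - 2) * ((2 * j + 1).factorial : ℂ)) *
          ((2 * d - 2 * j - 1).choose d : ℂ)) +
      (∑ j ∈ range ((d + 2) / 4),
        zetaConv (n - 2 * j) *
          ((-1 : ℂ) ^ j * (Real.pi : ℂ) ^ (4 * j) /
            ((2 : ℂ) ^ (2 * (d : ℤ) - 2 * (j : ℤ) - 5) * ((4 * j + 2).factorial : ℂ))) *
          ((2 * d - 4 * j - 2).choose d : ℂ)) := by
  have hpi : (Real.pi : ℂ) ≠ 0 := by exact_mod_cast Real.pi_ne_zero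
  have hsq : ((-1 : ℂ) ^ d) ^ 2 = 1 := by rw [← pow_mul, mul_comm, pow_mul]; simp
  have h := two_smul_thetaChoose_sinCoshSeries Complex.I_sq hd
  set B := (systemCoeffFst (1 + Complex.I) d + systemCoeffFst (1 - Complex.I) d)
        + C Complex.I * (systemCoeffFst (1 + Complex.I) d - systemCoeffFst (1 - Complex.I) d)
          * (cotSeries ℂ * tanhQuotSeries ℂ)
        + (systemCoeffSnd (1 + Complex.I) d + systemCoeffSnd (1 - Complex.I) d) * cotSeries ℂ
        - C Complex.I * (systemCoeffSnd (1 + Complex.I) d - systemCoeffSnd (1 - Complex.I) d)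
          * tanhSeries ℂ with hB
  have hXi : C (2 : ℂ) * XiSeries d =
      C ((-1) ^ d) * rescale ((Real.pi : ℂ) ^ 2 / 4) B := by
    refine mul_right_cancel₀ prodSeries_ne_zero ?_
    have h' := congrArg (rescale ((Real.pi : ℂ) ^ 2 / 4)) h
    rw [smul_eq_C_mul, map_mul, map_mul, rescale_C, ← thetaChoose_rescale] at h'
    have h1 := XiSeries_mul_prodSeries d
    rw [prodSeries] at h1 ⊢
    linear_combination C (2 : ℂ) * h1 + C ((-1) ^ d) * h'
  -- the polynomial part has degree less than `d`
  have hzero (a : ℂ) : coeff n (systemCoeffFst a d) = 0 := by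
    rw [systemCoeffFst, coeff_mk, Nat.choose_eq_zero_of_lt (by omega)]
    simp
  have hn := congrArg (coeff n) hXi
  rw [coeff_C_mul, coeff_C_mul, coeff_rescale, XiSeries, coeff_mk, hB, add_sub_assoc, map_add,
    map_add, map_add, hzero, hzero, coeff_cot_tanh_part hd hdn, coeff_cot_add_tanh_part hd hdn,
    add_zero, zero_add, add_comm, mul_add, mul_add, mul_sum, mul_sum, mul_sum, mul_sum] at hn
  refine mul_left_cancel₀ (two_ne_zero (α := ℂ)) ?_
  rw [hn, mul_add, mul_sum, mul_sum]
  congr 1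
  · refine sum_congr rfl fun j hj => ?_
    have hj' := mem_range.mp hj
    obtain ⟨s, rfl⟩ := Nat.exists_eq_add_of_le (show j ≤ n by omega)
    have hz : (2 : ℂ) ^ (2 * (d : ℤ) - (j : ℤ) - 2) = 4 ^ d / 2 ^ j / 4 := by
      rw [zpow_sub₀ two_ne_zero, zpow_sub₀ two_ne_zero, zpow_mul, zpow_natCast, zpow_natCast]
      norm_num
    have h8 : (8 : ℂ) ^ j = 4 ^ j * 2 ^ j := by rw [← mul_pow]; norm_num
    have h0 : ((2 * j + 1).factorial : ℂ) ≠ 0 := by exact_mod_cast Nat.factorial_ne_zero _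
    generalize 2 * (j + s) - 2 * j = t
    rw [hz, h8, Nat.add_sub_cancel_left, div_pow, ← pow_mul, mul_add, pow_add (Real.pi : ℂ),
      pow_add (4 : ℂ)]
    generalize (-1 : ℂ) ^ d = e at hsq
    field_simp
    linear_combination 8 * zetaTilde (j + s) t * ((2 * d - 2 * j - 1).choose d : ℂ) * hsq
  · refine sum_congr rfl fun j hj => ?_
    have hj' := mem_range.mp hj
    obtain ⟨s, rfl⟩ := Nat.exists_eq_add_of_le (show 2 * j ≤ n by omega)
    have hz : (2 : ℂ) ^ (2 * (d : ℤ) - 2 * (j : ℤ) - 5) = 4 ^ d / 4 ^ j / 32 := by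
      rw [zpow_sub₀ two_ne_zero, zpow_sub₀ two_ne_zero, zpow_mul, zpow_mul, zpow_natCast,
        zpow_natCast]
      norm_num
    have h64 : (-64 : ℂ) ^ j = (-1) ^ j * 4 ^ j * 4 ^ (2 * j) := by
      rw [pow_mul, ← mul_pow, ← mul_pow]; norm_num
    have h0 : ((4 * j + 2).factorial : ℂ) ≠ 0 := by exact_mod_cast Nat.factorial_ne_zero _
    rw [hz, h64, Nat.add_sub_cancel_left, div_pow, ← pow_mul, mul_add, pow_add (Real.pi : ℂ),
      pow_add (4 : ℂ), ← mul_assoc 2 2 j, show 2 * 2 = 4 from rfl]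
    generalize (-1 : ℂ) ^ d = e at hsq
    field_simp
    linear_combination 64 * zetaConv s * ((2 * d - 4 * j - 2).choose d : ℂ) * hsq

end Coefficients

end AltEuler

/-- The explicit formula for `Ξ(2n, d)`, together with the convergence of all series involved,
the evaluation of `ζ(m̄)`, and the rationality of `Ξ(2n, d) / π^{2n}`.
The index `j` runs over `0 ≤ j ≤ ⌊(d-1)/2⌋` in the first sum and over `0 ≤ j ≤ ⌊(d-2)/4⌋`
in the second one, which is empty for `d = 1`. -/
theorem mainTheorem1 (n d : ℕ) (hd : 1 ≤ d) (hdn : d ≤ n) :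
    (∀ s ∈ AltEuler.comps n d,
      AltEuler.HasEulerSum (fun i => 2 * s i) (fun i => (-1) ^ s i) (AltEuler.xi s)) ∧
    (∀ m : ℕ, 2 ≤ m →
      AltEuler.HasEulerSum (fun _ : Fin 1 => m) (fun _ => -1) (AltEuler.zetaBar m) ∧
      (AltEuler.zetaBar m : ℂ) = ((2 : ℂ) ^ (1 - (m : ℤ)) - 1) * riemannZeta (m : ℂ)) ∧
    (AltEuler.Xi n d : ℂ) =
      (∑ j ∈ Finset.range ((d - 1) / 2 + 1),
        (-1 : ℂ) ^ (j / 2) * (Real.pi : ℂ) ^ (2 * j) * AltEuler.zetaTilde n (2 * n - 2 * j) /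
          ((2 : ℂ) ^ (2 * (d : ℤ) - (j : ℤ) - 2) * ((2 * j + 1).factorial : ℂ)) *
          ((2 * d - 2 * j - 1).choose d : ℂ)) +
      (∑ j ∈ Finset.range ((d + 2) / 4),
        AltEuler.zetaConv (n - 2 * j) *
          ((-1 : ℂ) ^ j * (Real.pi : ℂ) ^ (4 * j) /
            ((2 : ℂ) ^ (2 * (d : ℤ) - 2 * (j : ℤ) - 5) * ((4 * j + 2).factorial : ℂ))) *
          ((2 * d - 4 * j - 2).choose d : ℂ)) ∧
    ∃ q : ℚ, AltEuler.Xi n d = (q : ℝ) * Real.pi ^ (2 * n) := by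
  exact ⟨fun s hs => AltEuler.hasEulerSum_xi hs,
    fun m hm => ⟨AltEuler.hasEulerSum_eulerSum _ fun _ => hm, AltEuler.zetaBar_eq hm⟩,
    AltEuler.Xi_eq hd hdn, AltEuler.exists_rat_Xi_eq n d⟩
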